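/- Let $k$ be a field of characteristic different from $2$ and let $n\ge 0$. Let $E(n)$ be the Hopf algebra over $k$ generated by $c,x_1,\dots,x_n$ with relations $c^2=1$, $x_i^2=0$, $cx_i=-x_ic$, $x_ix_j=-x_jx_i$ for $i<j$, coproduct $\Delta(c)=c\otimes c$, $\Delta(x_i)=1\otimes x_i+x_i\otimes c$, counit $\varepsilon(c)=1$, $\varepsilon(x_i)=0$, and antipode $S(c)=c$, $S(x_i)=cx_i$. For increasing $s$-tuples $P=(p_1<\dots<p_s)$ and $F=(f_1<\dots<f_s)$ in $\{1,\dots,n\}$ put $|P|=|F|=s$ and $x_P=x_{p_1}\cdots x_{p_s}$ (with $x_\emptyset=1$), and for $A=(a_{ij})\in M_n(k)$ and $\eta\in S_s$ put $a_{P,\eta(F)}=a_{p_1,f_{\eta(1)}}\cdots a_{p_s,f_{\eta(s)}}$ (equal to $1$ if $s=0$). Define $$R_A=\tfrac12\sum_P(-1)^{\frac{|P|(|P|-1)}{2}}\sum_{F,\ |F|=|P|,\ \eta\in S_{|P|}}\operatorname{sign}(\eta)\,a_{P,\eta(F)}\bigl(x_P\otimes c^{|P|}x_F+cx_P\otimes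 c^{|P|}x_F+x_P\otimes c^{|P|+1}x_F-cx_P\otimes c^{|P|+1}x_F\bigr)\in E(n)\otimes E(n).$$ An element $R$ of $H\otimes H$, for a Hopf algebra $H$ with flip map $\tau$, is a quasi-triangular structure if it is invertible, $\tau(\Delta(h))R=R\Delta(h)$ for all $h\in H$, $(\Delta\otimes\mathrm{id})(R)=R_{13}R_{23}$ and $(\mathrm{id}\otimes\Delta)(R)=R_{13}R_{12}$; it is triangular if moreover $\tau(R)=R^{-1}$. **Proposition.** For every $A\in M_n(k)$, the element $R_A$ is a quasi-triangular structure on $E(n)$, and it is triangular if and only if $A$ is symmetric. -/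

import Mathlib

open scoped TensorProduct

noncomputable section

/-! ### Quasi-triangular and triangular structures on a Hopf algebra -/

namespace QT

variable (k : Type*) [CommRing k] (H : Type*) [Ring H] [HopfAlgebra k H]

/-- The flip `τ : a ⊗ b ↦ b ⊗ a` on `H ⊗ H`. -/
def flip : H ⊗[k] H →ₐ[k] H ⊗[k] H :=
  (Algebra.TensorProduct.comm k H H).toAlgHom

/-- `R ↦ R₁₂`, that is `a ⊗ b ↦ a ⊗ b ⊗ 1`. -/
def leg12 : H ⊗[k] H →ₐ[k] H ⊗[k] (H ⊗[k] H) :=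
  Algebra.TensorProduct.map (AlgHom.id k H) Algebra.TensorProduct.includeLeft

/-- `R ↦ R₁₃`, that is `a ⊗ b ↦ a ⊗ 1 ⊗ b`. -/
def leg13 : H ⊗[k] H →ₐ[k] H ⊗[k] (H ⊗[k] H) :=
  Algebra.TensorProduct.map (AlgHom.id k H) Algebra.TensorProduct.includeRight

/-- `R ↦ R₂₃`, that is `a ⊗ b ↦ 1 ⊗ a ⊗ b`. -/
def leg23 : H ⊗[k] H →ₐ[k] H ⊗[k] (H ⊗[k] H) :=
  Algebra.TensorProduct.includeRight

/-- `Δ ⊗ id`, with values in `H ⊗ (H ⊗ H)`. -/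
def comulLeft : H ⊗[k] H →ₐ[k] H ⊗[k] (H ⊗[k] H) :=
  (Algebra.TensorProduct.assoc k k k H H H).toAlgHom.comp
    (Algebra.TensorProduct.map (Bialgebra.comulAlgHom k H) (AlgHom.id k H))

/-- `id ⊗ Δ`. -/
def comulRight : H ⊗[k] H →ₐ[k] H ⊗[k] (H ⊗[k] H) :=
  Algebra.TensorProduct.map (AlgHom.id k H) (Bialgebra.comulAlgHom k H)

variable {H}

/-- `R` is a quasi-triangular structure (universal `R`-matrix) on the Hopf algebra `H`. -/
structure IsQuasiTriangular (R : H ⊗[k] H) : Prop where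
  isUnit : IsUnit R
  comul_op : ∀ h : H, flip k H (Coalgebra.comul h) * R = R * Coalgebra.comul h
  comul_left : comulLeft k H R = leg13 k H R * leg23 k H R
  comul_right : comulRight k H R = leg13 k H R * leg12 k H R

/-- `R` is a triangular structure: it is quasi-triangular and `τ(R) = R⁻¹`. -/
structure IsTriangular (R : H ⊗[k] H) : Prop extends IsQuasiTriangular k R where
  mul_flip : R * flip k H R = 1
  flip_mul : flip k H R * R = 1

end QT

/-! ### The Hopf algebra `E(n)` -/

/-- The generators `c, x₁, …, xₙ`. -/
inductive EGen (n : ℕ) : Type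
  | c : EGen n
  | x : Fin n → EGen n

/-- The defining relations of `E(n)`. -/
inductive ERel (k : Type*) [Field k] (n : ℕ) :
    FreeAlgebra k (EGen n) → FreeAlgebra k (EGen n) → Prop
  | c_sq : ERel k n (FreeAlgebra.ι k EGen.c * FreeAlgebra.ι k EGen.c) 1
  | x_sq (i : Fin n) :
      ERel k n (FreeAlgebra.ι k (EGen.x i) * FreeAlgebra.ι k (EGen.x i)) 0
  | c_x (i : Fin n) :
      ERel k n (FreeAlgebra.ι k EGen.c * FreeAlgebra.ι k (EGen.x i))
        (-(FreeAlgebra.ι k (EGen.x i) * FreeAlgebra.ι k EGen.c))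
  | x_x (i j : Fin n) (h : i < j) :
      ERel k n (FreeAlgebra.ι k (EGen.x i) * FreeAlgebra.ι k (EGen.x j))
        (-(FreeAlgebra.ι k (EGen.x j) * FreeAlgebra.ι k (EGen.x i)))

/-- The algebra `E(n)` over `k`, given by generators and relations. -/
def E (k : Type*) [Field k] (n : ℕ) : Type _ := RingQuot (ERel k n)

namespace E

variable (k : Type*) [Field k] (n : ℕ)

instance : Ring (E k n) := inferInstanceAs (Ring (RingQuot (ERel k n)))

instance : Algebra k (E k n) := inferInstanceAs (Algebra k (RingQuot (ERel k n)))

/-- The quotient map from the free algebra. -/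
def mk : FreeAlgebra k (EGen n) →ₐ[k] E k n := RingQuot.mkAlgHom k (ERel k n)

/-- The generator `c`. -/
def c : E k n := mk k n (FreeAlgebra.ι k EGen.c)

variable {n} in
/-- The generator `x_i`. -/
def x (i : Fin n) : E k n := mk k n (FreeAlgebra.ι k (EGen.x i))

variable {k n}

theorem mk_rel {a b : FreeAlgebra k (EGen n)} (h : ERel k n a b) : mk k n a = mk k n b :=
  RingQuot.mkAlgHom_rel k h

theorem c_mul_c : c k n * c k n = 1 := by
  simpa [c] using mk_rel (ERel.c_sq (k := k) (n := n))

theorem x_mul_x (i : Fin n) : x k i * x k i = 0 := by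
  simpa [x] using mk_rel (ERel.x_sq (k := k) i)

theorem c_mul_x (i : Fin n) : c k n * x k i = -(x k i * c k n) := by
  simpa [x, c] using mk_rel (ERel.c_x (k := k) i)

theorem x_mul_x_anti (i j : Fin n) : x k i * x k j = -(x k j * x k i) := by
  rcases lt_trichotomy i j with h | h | h
  · simpa [x] using mk_rel (ERel.x_x (k := k) i j h)
  · subst h; simp [x_mul_x]
  · rw [eq_neg_iff_add_eq_zero, add_comm, ← eq_neg_iff_add_eq_zero]
    simpa [x] using mk_rel (ERel.x_x (k := k) j i h)

/-- The universal property of `E(n)`. -/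
def lift {B : Type*} [Ring B] [Algebra k B] (c' : B) (x' : Fin n → B)
    (h1 : c' * c' = 1) (h2 : ∀ i, x' i * x' i = 0) (h3 : ∀ i, c' * x' i = -(x' i * c'))
    (h4 : ∀ i j, i < j → x' i * x' j = -(x' j * x' i)) : E k n →ₐ[k] B :=
  RingQuot.liftAlgHom k (s := ERel k n)
    ⟨FreeAlgebra.lift k (fun g => match g with
      | EGen.c => c'
      | EGen.x i => x' i), by
      intro a b h
      cases h with
      | c_sq => simpa using h1
      | x_sq i => simpa using h2 i
      | c_x i => simpa using h3 i
      | x_x i j h => simpa using h4 i j h⟩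

section lift
variable {B : Type*} [Ring B] [Algebra k B] (c' : B) (x' : Fin n → B)
    (h1 : c' * c' = 1) (h2 : ∀ i, x' i * x' i = 0) (h3 : ∀ i, c' * x' i = -(x' i * c'))
    (h4 : ∀ i j, i < j → x' i * x' j = -(x' j * x' i))

@[simp] theorem lift_c : lift (k := k) c' x' h1 h2 h3 h4 (c k n) = c' := by
  unfold lift c mk
  erw [RingQuot.liftAlgHom_mkAlgHom_apply]
  simp

@[simp] theorem lift_x (i : Fin n) : lift (k := k) c' x' h1 h2 h3 h4 (x k i) = x' i := by
  unfold lift x mk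
  erw [RingQuot.liftAlgHom_mkAlgHom_apply]
  simp

end lift

theorem hom_ext {B : Type*} [Semiring B] [Algebra k B] {f g : E k n →ₐ[k] B}
    (hc : f (c k n) = g (c k n)) (hx : ∀ i, f (x k i) = g (x k i)) : f = g := by
  refine RingQuot.ringQuot_ext' k f g (FreeAlgebra.hom_ext ?_)
  funext a
  cases a with
  | c => exact hc
  | x i => exact hx i

theorem induction {P : E k n → Prop} (hk : ∀ r : k, P (algebraMap k _ r))
    (hc : P (c k n)) (hx : ∀ i, P (x k i)) (hadd : ∀ a b, P a → P b → P (a + b))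
    (hmul : ∀ a b, P a → P b → P (a * b)) (a : E k n) : P a := by
  obtain ⟨a, rfl⟩ : ∃ b, mk k n b = a := RingQuot.mkAlgHom_surjective k (ERel k n) a
  induction a using FreeAlgebra.induction with
  | grade0 r => simpa using hk r
  | grade1 g => cases g with
    | c => exact hc
    | x i => exact hx i
  | mul a b ha hb => simpa using hmul _ _ ha hb
  | add a b ha hb => simpa using hadd _ _ ha hb

variable (k n)

/-- The coproduct: `Δ(c) = c ⊗ c`, `Δ(x_i) = 1 ⊗ x_i + x_i ⊗ c`. -/
def comulHom : E k n →ₐ[k] E k n ⊗[k] E k n :=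
  lift (c k n ⊗ₜ c k n) (fun i => 1 ⊗ₜ x k i + x k i ⊗ₜ c k n)
    (by simp [c_mul_c, Algebra.TensorProduct.one_def])
    (fun i => by
      simp [mul_add, add_mul, x_mul_x, c_mul_x, TensorProduct.tmul_neg])
    (fun i => by
      simp [mul_add, add_mul, c_mul_x, TensorProduct.tmul_neg, TensorProduct.neg_tmul]
      abel)
    (fun i j _ => by
      simp only [mul_add, add_mul, Algebra.TensorProduct.tmul_mul_tmul, one_mul, mul_one,
        c_mul_x, c_mul_c, x_mul_x_anti i j, TensorProduct.tmul_neg, TensorProduct.neg_tmul]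
      abel)

/-- The counit: `ε(c) = 1`, `ε(x_i) = 0`. -/
def counitHom : E k n →ₐ[k] k :=
  lift 1 (fun _ => 0) (by simp) (by simp) (by simp) (by simp)

/-- The antipode `S(c) = c`, `S(x_i) = c x_i`, as an algebra map to the opposite algebra. -/
def antipodeHom : E k n →ₐ[k] (E k n)ᵐᵒᵖ :=
  lift (MulOpposite.op (c k n)) (fun i => MulOpposite.op (c k n * x k i))
    (by rw [← MulOpposite.op_mul, c_mul_c, MulOpposite.op_one])
    (fun i => by
      rw [← MulOpposite.op_mul, ← MulOpposite.op_zero, mul_assoc, ← mul_assoc (x k i),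
        ← neg_neg (x k i * c k n), ← c_mul_x, neg_mul, mul_assoc, x_mul_x]
      simp)
    (fun i => by
      rw [← MulOpposite.op_mul, ← MulOpposite.op_mul, ← MulOpposite.op_neg, mul_assoc,
        ← neg_neg (x k i * c k n), ← c_mul_x, mul_neg])
    (fun i j _ => by
      have key : ∀ a b : Fin n, (c k n * x k a) * (c k n * x k b) = -(x k a * x k b) := by
        intro a b
        rw [c_mul_x a, neg_mul, mul_assoc, ← mul_assoc (c k n), c_mul_c, one_mul]
      rw [← MulOpposite.op_mul, ← MulOpposite.op_mul, ← MulOpposite.op_neg, key, key,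
        x_mul_x_anti j i])

@[simp] theorem comulHom_c : comulHom k n (c k n) = c k n ⊗ₜ c k n := lift_c ..

@[simp] theorem comulHom_x (i : Fin n) :
    comulHom k n (x k i) = 1 ⊗ₜ x k i + x k i ⊗ₜ c k n := lift_x ..

@[simp] theorem counitHom_c : counitHom k n (c k n) = 1 := lift_c ..

@[simp] theorem counitHom_x (i : Fin n) : counitHom k n (x k i) = 0 := lift_x ..

@[simp] theorem antipodeHom_c : antipodeHom k n (c k n) = MulOpposite.op (c k n) := lift_c ..

@[simp] theorem antipodeHom_x (i : Fin n) :
    antipodeHom k n (x k i) = MulOpposite.op (c k n * x k i) := lift_x ..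

instance : Bialgebra k (E k n) :=
  Bialgebra.ofAlgHom (comulHom k n) (counitHom k n)
    (by
      apply hom_ext
      · simp
      · intro i
        simp [TensorProduct.tmul_add, TensorProduct.add_tmul, Algebra.TensorProduct.one_def,
          add_assoc])
    (by apply hom_ext <;> simp)
    (by apply hom_ext <;> simp)

@[simp] theorem comul_c : Coalgebra.comul (R := k) (c k n) = c k n ⊗ₜ[k] c k n :=
  comulHom_c k n

@[simp] theorem comul_x (i : Fin n) :
    Coalgebra.comul (R := k) (x k i) = 1 ⊗ₜ[k] x k i + x k i ⊗ₜ[k] c k n :=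
  comulHom_x k n i

@[simp] theorem counit_c : Coalgebra.counit (R := k) (c k n) = 1 := counitHom_c k n

@[simp] theorem counit_x (i : Fin n) : Coalgebra.counit (R := k) (x k i) = 0 :=
  counitHom_x k n i

/-- The antipode as a linear map. -/
def antipodeLin : E k n →ₗ[k] E k n :=
  (MulOpposite.opLinearEquiv k).symm.toLinearMap ∘ₗ (antipodeHom k n).toLinearMap

@[simp] theorem antipodeLin_c : antipodeLin k n (c k n) = c k n := by simp [antipodeLin]

@[simp] theorem antipodeLin_x (i : Fin n) : antipodeLin k n (x k i) = c k n * x k i := by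
  simp [antipodeLin]

theorem antipodeLin_mul (a b : E k n) :
    antipodeLin k n (a * b) = antipodeLin k n b * antipodeLin k n a := by
  simp [antipodeLin]

@[simp] theorem antipodeLin_one : antipodeLin k n 1 = 1 := by simp [antipodeLin]

theorem antipode_left_mul (t : E k n ⊗[k] E k n) (u : E k n ⊗[k] E k n) (r : k)
    (ht : LinearMap.mul' k _ ((antipodeLin k n).rTensor _ t) = algebraMap k _ r) :
    LinearMap.mul' k _ ((antipodeLin k n).rTensor _ (t * u)) =
      algebraMap k _ r * LinearMap.mul' k _ ((antipodeLin k n).rTensor _ u) := by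
  induction u using TensorProduct.induction_on with
  | zero => simp
  | add u v hu hv => simp only [mul_add, map_add, hu, hv]
  | tmul a b =>
    have h : ∀ s : E k n ⊗[k] E k n,
        LinearMap.mul' k _ ((antipodeLin k n).rTensor _ (s * (a ⊗ₜ b))) =
          antipodeLin k n a * LinearMap.mul' k _ ((antipodeLin k n).rTensor _ s) * b := by
      intro s
      induction s using TensorProduct.induction_on with
      | zero => simp
      | add u v hu hv => simp only [add_mul, mul_add, map_add, hu, hv]
      | tmul p q => simp [antipodeLin_mul, mul_assoc]
    rw [h, ht, ← Algebra.commutes]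
    simp [mul_assoc]

theorem antipode_right_mul (t : E k n ⊗[k] E k n) (u : E k n ⊗[k] E k n) (r : k)
    (hu : LinearMap.mul' k _ ((antipodeLin k n).lTensor _ u) = algebraMap k _ r) :
    LinearMap.mul' k _ ((antipodeLin k n).lTensor _ (t * u)) =
      LinearMap.mul' k _ ((antipodeLin k n).lTensor _ t) * algebraMap k _ r := by
  induction t using TensorProduct.induction_on with
  | zero => simp
  | add t v ht hv => simp only [add_mul, map_add, ht, hv]
  | tmul a b =>
    have h : ∀ s : E k n ⊗[k] E k n,
        LinearMap.mul' k _ ((antipodeLin k n).lTensor _ ((a ⊗ₜ b) * s)) =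
          a * LinearMap.mul' k _ ((antipodeLin k n).lTensor _ s) * antipodeLin k n b := by
      intro s
      induction s using TensorProduct.induction_on with
      | zero => simp
      | add u v hu hv => simp only [add_mul, mul_add, map_add, hu, hv]
      | tmul p q => simp [antipodeLin_mul, mul_assoc]
    rw [h, hu, mul_assoc, Algebra.commutes]
    simp [mul_assoc]

instance : HopfAlgebra k (E k n) where
  antipode := antipodeLin k n
  mul_antipode_rTensor_comul := by
    ext a
    induction a using E.induction with
    | hk r => simp [Algebra.algebraMap_eq_smul_one, Algebra.TensorProduct.one_def]
    | hc => simp [c_mul_c]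
    | hx i => simp [c_mul_x, mul_assoc, c_mul_c]
    | hadd a b ha hb => simp only [map_add, ha, hb]
    | hmul a b ha hb =>
      simp only [LinearMap.comp_apply, Bialgebra.comul_mul, Bialgebra.counit_mul] at ha hb ⊢
      rw [antipode_left_mul k n _ _ _ ha, hb]
      simp
  mul_antipode_lTensor_comul := by
    ext a
    induction a using E.induction with
    | hk r => simp [Algebra.algebraMap_eq_smul_one, Algebra.TensorProduct.one_def]
    | hc => simp [c_mul_c]
    | hx i => simp [c_mul_x]
    | hadd a b ha hb => simp only [map_add, ha, hb]
    | hmul a b ha hb =>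
      simp only [LinearMap.comp_apply, Bialgebra.comul_mul, Bialgebra.counit_mul] at ha hb ⊢
      rw [antipode_right_mul k n _ _ _ hb, ha]
      simp

@[simp] theorem antipode_c : HopfAlgebra.antipode k (c k n) = c k n := antipodeLin_c k n

@[simp] theorem antipode_x (i : Fin n) : HopfAlgebra.antipode k (x k i) = c k n * x k i :=
  antipodeLin_x k n i

variable {n}

/-- `x_P`, the product of the `x_j` with `j` in the increasing tuple `P`, taken in order. -/
def xProd {s : ℕ} (P : Fin s ↪o Fin n) : E k n := (List.ofFn fun i => x k (P i)).prod

variable {k}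

/-- The `R`-matrix `R_A`; `P` and `F` run over the increasing `s`-tuples in `{1, …, n}`. -/
def RMatrix (A : Matrix (Fin n) (Fin n) k) : E k n ⊗[k] E k n :=
  (1 / 2 : k) • ∑ s ∈ Finset.range (n + 1), ∑ P : Fin s ↪o Fin n,
    (-1 : k) ^ (s * (s - 1) / 2) • ∑ F : Fin s ↪o Fin n, ∑ η : Equiv.Perm (Fin s),
      (((Equiv.Perm.sign η : ℤ) : k) * ∏ i : Fin s, A (P i) (F (η i))) •
        (xProd k P ⊗ₜ[k] (c k n ^ s * xProd k F)
          + (c k n * xProd k P) ⊗ₜ[k] (c k n ^ s * xProd k F)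
          + xProd k P ⊗ₜ[k] (c k n ^ (s + 1) * xProd k F)
          - (c k n * xProd k P) ⊗ₜ[k] (c k n ^ (s + 1) * xProd k F))

end E

end

/-! ### Products of lists in noncommutative rings -/

section ListProd

variable {ι κ B : Type*}

/-! The proof rests on a factorization R_A = g · T_A (`RMatrix_eq`). Here g = ½(1⊗1 + c⊗1 + 1⊗c −
c⊗c), and T_A is the product over p of 1 + x_p ⊗ c y_p, with y_p = Σ_j a_{pj} x_j. The elements x_p
⊗ c y_p commute and square to zero. Expanding T_A over increasing tuples P gives products of the
y_p, and the anticommutation of the x_j expands these into minors of A.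

The factor T_A commutes with every Δ(h), and g intertwines Δ with its flip. Applying Δ to a leg of
T_A splits off one auxiliary product, `midFactor`; moving g_23 or g_12 past the (1,3) leg of T_A
produces the same product, so the hexagon identities reduce to those for g.

Since g is fixed by the flip and g² = 1, moving g across τ(T_A) gives τ(R_A) R_A = (T_{Aᵀ})⁻¹ T_A.
Triangularity therefore means T_A = T_{Aᵀ}. As A ↦ T_A is injective, this is A = Aᵀ. -/

theorem List.prod_map_mul_of_commute [Monoid B] (l : List ι) (f g : ι → B)
    (h : ∀ i j, Commute (f i) (g j)) :
    (l.map fun i => f i * g i).prod = (l.map f).prod * (l.map g).prod := by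
  induction l with
  | nil => simp
  | cons a l ih =>
    have hc : Commute (g a) (l.map f).prod :=
      Commute.list_prod_right _ _ fun b hb => by
        obtain ⟨i, -, rfl⟩ := List.mem_map.1 hb
        exact (h i a).symm
    simp only [List.map_cons, List.prod_cons, ih]
    rw [mul_assoc, ← mul_assoc (g a), hc.eq]
    simp only [mul_assoc]

theorem List.prod_map_mul_eq_mul_prod_map [Monoid B] (l : List ι) (f g : ι → B) (r : B)
    (h : ∀ i, f i * r = r * g i) : (l.map f).prod * r = r * (l.map g).prod := by
  induction l with
  | nil => simp
  | cons a l ih =>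
    simp only [List.map_cons, List.prod_cons]
    rw [mul_assoc, ih, ← mul_assoc, h, mul_assoc]

theorem List.prod_map_prod_map_comm [Monoid B] (l : List ι) (m : List κ) (f : ι → κ → B)
    (h : ∀ i j i' j', Commute (f i j) (f i' j')) :
    (l.map fun i => (m.map fun j => f i j).prod).prod =
      (m.map fun j => (l.map fun i => f i j).prod).prod := by
  induction l with
  | nil => simp
  | cons a l ih =>
    simp only [List.map_cons, List.prod_cons]
    rw [ih, List.prod_map_mul_of_commute]
    intro i j
    refine Commute.list_prod_right _ _ fun b hb => ?_
    obtain ⟨p, -, rfl⟩ := List.mem_map.1 hb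
    exact h _ _ _ _

theorem List.prod_map_one_add_of_mul_eq_zero [Ring B] (l : List ι) (f : ι → B)
    (h : ∀ i j, f i * f j = 0) : (l.map fun i => 1 + f i).prod = 1 + (l.map f).sum := by
  induction l with
  | nil => simp
  | cons a l ih =>
    have h0 : f a * (l.map f).sum = 0 := by
      rw [← List.sum_map_mul_left]
      simp [h]
    simp only [List.map_cons, List.prod_cons, List.sum_cons, ih]
    rw [add_mul, mul_add (f a), one_mul, h0, mul_one]
    abel

theorem List.sum_map_finRange [AddCommMonoid B] {n : ℕ} (f : Fin n → B) :
    ((List.finRange n).map f).sum = ∑ i, f i := by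
  rw [← List.ofFn_eq_map, List.sum_ofFn]

end ListProd

/-! ### Expansion of products over increasing tuples -/

theorem Finset.sum_powersetCard_univ_eq_sum_orderEmbedding {n : ℕ} {M : Type*} [AddCommMonoid M]
    (s : ℕ) (f : Finset (Fin n) → M) :
    ∑ t ∈ Finset.powersetCard s (Finset.univ : Finset (Fin n)), f t =
      ∑ P : Fin s ↪o Fin n, f (Finset.univ.map P.toEmbedding) := by
  symm
  refine Finset.sum_bij' (fun P _ => Finset.univ.map P.toEmbedding)
    (fun t ht => t.orderEmbOfFin (Finset.mem_powersetCard.1 ht).2) ?_ ?_ ?_ ?_ ?_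
  · intro P _
    simp [Finset.mem_powersetCard]
  · intro t ht
    simp
  · intro P _
    symm
    apply Finset.orderEmbOfFin_unique'
    intro i
    simp
  · intro t ht
    simp
  · intro P _
    rfl

open scoped IsMulCommutative in
-- The u i generate a commutative subring, where the usual expansion of ∏(1 + u i) over subsets
-- applies; subsets of size s are increasing s-tuples.
theorem prod_one_add_eq_sum_orderEmbedding {B : Type*} [Ring B] {n : ℕ} (u : Fin n → B)
    (hu : ∀ i j, Commute (u i) (u j)) :
    ((List.finRange n).map fun i => 1 + u i).prod =
      ∑ s ∈ Finset.range (n + 1), ∑ P : Fin s ↪o Fin n, (List.ofFn fun i => u (P i)).prod := by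
  have hc : ∀ a ∈ Set.range u, ∀ b ∈ Set.range u, a * b = b * a := by
    rintro _ ⟨i, rfl⟩ _ ⟨j, rfl⟩
    exact hu i j
  have := Algebra.isMulCommutative_adjoin ℤ hc
  let v : Fin n → Algebra.adjoin ℤ (Set.range u) :=
    fun i => ⟨u i, Algebra.subset_adjoin ⟨i, rfl⟩⟩
  have key : ((List.finRange n).map fun i => 1 + v i).prod =
      ∑ s ∈ Finset.range (n + 1), ∑ P : Fin s ↪o Fin n, (List.ofFn fun i => v (P i)).prod := by
    rw [← List.ofFn_eq_map, List.prod_ofFn, Finset.prod_one_add, Finset.sum_powerset]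
    simp only [Finset.card_univ, Fintype.card_fin,
      Finset.sum_powersetCard_univ_eq_sum_orderEmbedding, List.prod_ofFn, Finset.prod_map]
    rfl
  have hv : ∀ i, (Algebra.adjoin ℤ (Set.range u)).val (v i) = u i := fun _ => rfl
  have := congrArg (Algebra.adjoin ℤ (Set.range u)).val key
  simpa only [hv, map_sum, map_list_prod, List.map_map, List.map_ofFn, Function.comp_def, map_add,
    map_one] using this

/-- Sorting g gives the increasing tuple, and the inverse of the sorting permutation recovers g. -/
theorem exists_orderEmbedding_perm {s n : ℕ} {g : Fin s → Fin n} (hg : Function.Injective g) :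
    ∃ (F : Fin s ↪o Fin n) (η : Equiv.Perm (Fin s)), (fun i => F (η i)) = g := by
  refine ⟨OrderEmbedding.ofStrictMono (g ∘ Tuple.sort g)
    ((Tuple.monotone_sort g).strictMono_of_injective (hg.comp (Tuple.sort g).injective)),
    (Tuple.sort g)⁻¹, ?_⟩
  funext i
  simp

theorem orderEmbedding_perm_injective {s n : ℕ} :
    Function.Injective
      (fun (p : (Fin s ↪o Fin n) × Equiv.Perm (Fin s)) (i : Fin s) => p.1 (p.2 i)) := by
  rintro ⟨F, η⟩ ⟨F', η'⟩ h
  have h' : ∀ i, F (η i) = F' (η' i) := fun i => congrFun h i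
  have hF : F = F' := by
    apply OrderEmbedding.range_inj.1
    ext j
    constructor
    · rintro ⟨i, rfl⟩
      exact ⟨η' (η.symm i), by rw [← h']; simp⟩
    · rintro ⟨i, rfl⟩
      exact ⟨η (η'.symm i), by rw [h']; simp⟩
  subst hF
  simp only [Prod.mk.injEq, true_and]
  ext i
  rw [F.injective (h' i)]

/-- Multilinear expansion gives a sum over all index maps g. The non-injective ones repeat an
argument and vanish; each injective one is uniquely an increasing tuple after a permutation, whose
sign comes out by alternation. -/
theorem AlternatingMap.map_sum_smul_eq_sum_orderEmbedding {R M N : Type*} [CommRing R]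
    [AddCommGroup M] [Module R M] [AddCommGroup N] [Module R N] {s n : ℕ}
    (f : M [⋀^Fin s]→ₗ[R] N) (a : Fin s → Fin n → R) (e : Fin n → M) :
    f (fun i => ∑ j, a i j • e j) =
      ∑ F : Fin s ↪o Fin n, ∑ η : Equiv.Perm (Fin s),
        (((Equiv.Perm.sign η : ℤ) : R) * ∏ i, a i (F (η i))) • f (fun i => e (F i)) := by
  classical
  have h1 : f (fun i => ∑ j, a i j • e j) =
      ∑ g : Fin s → Fin n, (∏ i, a i (g i)) • f (fun i => e (g i)) := by
    have := f.toMultilinearMap.map_sum (fun i j => a i j • e j)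
    simp only [AlternatingMap.coe_multilinearMap] at this
    rw [this]
    refine Finset.sum_congr rfl fun g _ => ?_
    exact f.toMultilinearMap.map_smul_univ (fun i => a i (g i)) (fun i => e (g i))
  rw [h1, ← Fintype.sum_prod_type']
  symm
  refine Finset.sum_of_injOn
    (fun (p : (Fin s ↪o Fin n) × Equiv.Perm (Fin s)) (i : Fin s) => p.1 (p.2 i))
    orderEmbedding_perm_injective.injOn (by simp) ?_ ?_
  · intro g _ hg
    have hng : ¬ Function.Injective g := fun h => by
      obtain ⟨F, η, rfl⟩ := exists_orderEmbedding_perm h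
      exact hg ⟨(F, η), by simp, rfl⟩
    rw [f.map_eq_zero_of_not_injective _ fun h => hng fun i j hij => h (by simp [hij]), smul_zero]
  · rintro ⟨F, η⟩ -
    have := f.map_perm (fun i => e (F i)) η
    simp only [Function.comp_def] at this
    rw [this, mul_comm, mul_smul, Units.smul_def, Int.cast_smul_eq_zsmul]

/-- The square-zero hypothesis extends the x j to an algebra map out of the exterior algebra, so the
ordered product is an alternating function of the coefficient vectors. -/
theorem prod_ofFn_sum_smul {R B : Type*} [CommRing R] [Ring B] [Algebra R B] {s n : ℕ}
    (x : Fin n → B) (hx : ∀ m : Fin n → R, (∑ j, m j • x j) * (∑ j, m j • x j) = 0)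
    (a : Fin s → Fin n → R) :
    (List.ofFn fun i => ∑ j, a i j • x j).prod =
      ∑ F : Fin s ↪o Fin n, ∑ η : Equiv.Perm (Fin s),
        (((Equiv.Perm.sign η : ℤ) : R) * ∏ i, a i (F (η i))) •
          (List.ofFn fun i => x (F i)).prod := by
  classical
  let Φ : ExteriorAlgebra R (Fin n → R) →ₐ[R] B :=
    ExteriorAlgebra.lift R ⟨Fintype.linearCombination R x, fun m => by
      simpa [Fintype.linearCombination_apply] using hx m⟩
  have hΦ : ∀ m, Φ (ExteriorAlgebra.ι R m) = ∑ j, m j • x j := fun m => by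
    simp [Φ, Fintype.linearCombination_apply]
  let f : (Fin n → R) [⋀^Fin s]→ₗ[R] B :=
    Φ.toLinearMap.compAlternatingMap (ExteriorAlgebra.ιMulti R s)
  have hf : ∀ v, f v = (List.ofFn fun i => ∑ j, v i j • x j).prod := fun v => by
    simp [f, ExteriorAlgebra.ιMulti_apply, map_list_prod, List.map_ofFn, Function.comp_def, hΦ]
  have := f.map_sum_smul_eq_sum_orderEmbedding a (fun j => Pi.single j (1 : R))
  simpa [hf, Finset.sum_apply, Pi.single_apply, ite_smul] using this

/-! ### Factorization of R_A into a group-like part and an odd part. -/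

namespace E

variable {k : Type*} [Field k] {n : ℕ}

/-- The linear combination `∑ v_j x_j` of the odd generators. -/
def lin (v : Fin n → k) : E k n := ∑ j, v j • x k j

theorem c_mul_lin (v : Fin n → k) : c k n * lin v = -(lin v * c k n) := by
  simp [lin, Finset.mul_sum, Finset.sum_mul, c_mul_x]

theorem x_mul_lin (i : Fin n) (v : Fin n → k) : x k i * lin v = -(lin v * x k i) := by
  simp only [lin, Finset.mul_sum, Finset.sum_mul, ← Finset.sum_neg_distrib]
  refine Finset.sum_congr rfl fun j _ => ?_
  rw [mul_smul_comm, smul_mul_assoc, x_mul_x_anti i j, smul_neg]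

theorem lin_mul_lin_anti (v w : Fin n → k) : lin v * lin w = -(lin w * lin v) := by
  conv_lhs => rw [lin]
  conv_rhs => rw [lin.eq_1 v]
  simp only [Finset.mul_sum, Finset.sum_mul, ← Finset.sum_neg_distrib]
  refine Finset.sum_congr rfl fun j _ => ?_
  rw [mul_smul_comm, smul_mul_assoc, x_mul_lin, smul_neg]

theorem lin_mul_lin_self (h2 : (2 : k) ≠ 0) (v : Fin n → k) : lin v * lin v = 0 := by
  have h : (2 : k) • (lin v * lin v) = 0 := by
    rw [two_smul]
    nth_rewrite 1 [lin_mul_lin_anti]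
    exact neg_add_cancel _
  exact (smul_eq_zero.1 h).resolve_left h2

theorem c_mul_lin_mul_c_mul_lin (v w : Fin n → k) :
    (c k n * lin v) * (c k n * lin w) = -(lin v * lin w) := by
  rw [c_mul_lin v, neg_mul, mul_assoc, ← mul_assoc (c k n), c_mul_c, one_mul]

theorem comul_lin (v : Fin n → k) :
    Coalgebra.comul (R := k) (lin v) = 1 ⊗ₜ[k] lin v + lin v ⊗ₜ[k] c k n := by
  simp [lin, TensorProduct.tmul_sum, TensorProduct.sum_tmul, Finset.sum_add_distrib,
    TensorProduct.tmul_smul, TensorProduct.smul_tmul']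

theorem odd_mul_c_pow {y : E k n} (hy : c k n * y = -(y * c k n)) (s : ℕ) :
    y * c k n ^ s = (-1 : k) ^ s • (c k n ^ s * y) := by
  induction s with
  | zero => simp
  | succ s ih =>
    rw [pow_succ (c k n), ← mul_assoc, ih, smul_mul_assoc, mul_assoc, mul_assoc, hy, pow_succ,
      mul_neg_one, neg_smul, mul_neg, smul_neg, neg_neg]

/-- Collecting all the c's on the left moves them past 0 + 1 + ⋯ + (s−1) odd elements in total; this
is the source of the sign (−1)^{s(s−1)/2}. -/
theorem prod_ofFn_tmul {s : ℕ} (a y : Fin s → E k n)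
    (hy : ∀ i, c k n * y i = -(y i * c k n)) :
    (List.ofFn fun i => a i ⊗ₜ[k] (c k n * y i)).prod =
      (-1 : k) ^ (s * (s - 1) / 2) •
        ((List.ofFn a).prod ⊗ₜ[k] (c k n ^ s * (List.ofFn y).prod)) := by
  induction s with
  | zero => simp [Algebra.TensorProduct.one_def]
  | succ s ih =>
    rw [List.ofFn_succ, List.prod_cons, ih _ _ fun i => hy i.succ, Nat.triangle_succ,
      List.ofFn_succ (f := a), List.ofFn_succ (f := y), List.prod_cons, List.prod_cons,
      mul_smul_comm, Algebra.TensorProduct.tmul_mul_tmul, pow_add, mul_smul]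
    congr 1
    rw [mul_assoc, ← mul_assoc (y 0), odd_mul_c_pow (hy 0), smul_mul_assoc, mul_smul_comm,
      TensorProduct.tmul_smul, pow_succ' (c k n)]
    simp only [mul_assoc]

variable (k n) in
/-- The element `½ (1 ⊗ 1 + c ⊗ 1 + 1 ⊗ c - c ⊗ c)`. -/
def groupR : E k n ⊗[k] E k n :=
  (1 / 2 : k) • (1 ⊗ₜ 1 + c k n ⊗ₜ 1 + 1 ⊗ₜ c k n - c k n ⊗ₜ c k n)

/-- The product of the elements `1 + x_p ⊗ c y_p`, where `y_p = ∑ a_{pj} x_j`. -/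
def oddFactor (A : Matrix (Fin n) (Fin n) k) : E k n ⊗[k] E k n :=
  ((List.finRange n).map fun p => 1 + x k p ⊗ₜ[k] (c k n * lin (A p))).prod

/-- The two signs, one from each leg, cancel. -/
theorem commute_tmul {a b a' b' : E k n} (ha : a * a' = -(a' * a)) (hb : b * b' = -(b' * b)) :
    Commute (a ⊗ₜ[k] b) (a' ⊗ₜ[k] b') := by
  simp [Commute, SemiconjBy, ha, hb, TensorProduct.tmul_neg, TensorProduct.neg_tmul]

theorem c_mul_lin_anti (v w : Fin n → k) :
    (c k n * lin v) * (c k n * lin w) = -((c k n * lin w) * (c k n * lin v)) := by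
  rw [c_mul_lin_mul_c_mul_lin, c_mul_lin_mul_c_mul_lin, lin_mul_lin_anti]

/-- The expansion over P comes from the commuting factors of T_A, and that over F and η from the
product of the rows y_p. Multiplying by the four terms of g gives the four terms in the definition.
-/
theorem RMatrix_eq (h2 : (2 : k) ≠ 0) (A : Matrix (Fin n) (Fin n) k) :
    RMatrix A = groupR k n * oddFactor A := by
  have hT := prod_one_add_eq_sum_orderEmbedding (fun p => x k p ⊗ₜ[k] (c k n * lin (A p)))
    fun i j => commute_tmul (x_mul_x_anti i j) (c_mul_lin_anti _ _)
  rw [RMatrix, groupR, oddFactor, hT, smul_mul_assoc, Finset.mul_sum]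
  congr 1
  refine Finset.sum_congr rfl fun s _ => ?_
  rw [Finset.mul_sum]
  refine Finset.sum_congr rfl fun P _ => ?_
  rw [prod_ofFn_tmul _ _ fun i => c_mul_lin _, mul_smul_comm]
  congr 1
  have h := prod_ofFn_sum_smul (R := k) (x k (n := n)) (lin_mul_lin_self h2)
    (fun i : Fin s => A (P i))
  simp only [lin]
  rw [h]
  simp only [Finset.mul_sum, TensorProduct.tmul_sum]
  refine Finset.sum_congr rfl fun F _ => Finset.sum_congr rfl fun η _ => ?_
  rw [mul_smul_comm, TensorProduct.tmul_smul, mul_smul_comm]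
  congr 1
  simp only [xProd, sub_mul, add_mul, Algebra.TensorProduct.tmul_mul_tmul, one_mul,
    pow_succ', mul_assoc]

/-! ### The group-like part, and compatibility with the flipped coproduct. -/

theorem groupR_mul_self (h2 : (2 : k) ≠ 0) : groupR k n * groupR k n = 1 := by
  have h : (1 ⊗ₜ[k] 1 + c k n ⊗ₜ[k] 1 + 1 ⊗ₜ[k] c k n - c k n ⊗ₜ[k] c k n) *
      (1 ⊗ₜ[k] 1 + c k n ⊗ₜ[k] 1 + 1 ⊗ₜ[k] c k n - c k n ⊗ₜ[k] c k n) =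
      (2 * 2 : k) • (1 ⊗ₜ[k] 1) := by
    simp only [mul_add, add_mul, mul_sub, sub_mul, Algebra.TensorProduct.tmul_mul_tmul, one_mul,
      mul_one, c_mul_c]
    module
  rw [groupR, smul_mul_smul_comm, h, smul_smul, Algebra.TensorProduct.one_def]
  rw [show (1 / 2 * (1 / 2) * (2 * 2) : k) = 1 by field_simp, one_smul]

/-- On joint eigenspaces of c ⊗ 1 and 1 ⊗ c, g is −1 when both eigenvalues are −1 and 1 otherwise.
An odd a exchanges the eigenvalues of c in its leg, so g changes by the eigenvalue of c in the other
leg. -/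
theorem odd_tmul_one_mul_groupR {a : E k n} (ha : c k n * a = -(a * c k n)) :
    (a ⊗ₜ[k] 1) * groupR k n = groupR k n * (a ⊗ₜ[k] c k n) := by
  rw [groupR, mul_smul_comm, smul_mul_assoc]
  congr 1
  simp only [mul_add, add_mul, mul_sub, sub_mul, Algebra.TensorProduct.tmul_mul_tmul, one_mul,
    mul_one, c_mul_c, ha, TensorProduct.neg_tmul]
  abel

theorem one_tmul_odd_mul_groupR {a : E k n} (ha : c k n * a = -(a * c k n)) :
    (1 ⊗ₜ[k] a) * groupR k n = groupR k n * (c k n ⊗ₜ[k] a) := by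
  rw [groupR, mul_smul_comm, smul_mul_assoc]
  congr 1
  simp only [mul_add, add_mul, mul_sub, sub_mul, Algebra.TensorProduct.tmul_mul_tmul, one_mul,
    mul_one, c_mul_c, ha, TensorProduct.tmul_neg]
  abel

theorem commute_c_tmul_one_groupR : Commute (c k n ⊗ₜ[k] 1) (groupR k n) := by
  rw [Commute, SemiconjBy, groupR, mul_smul_comm, smul_mul_assoc]
  simp [mul_add, add_mul, mul_sub, sub_mul]

theorem commute_one_tmul_c_groupR : Commute (1 ⊗ₜ[k] c k n) (groupR k n) := by
  rw [Commute, SemiconjBy, groupR, mul_smul_comm, smul_mul_assoc]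
  simp [mul_add, add_mul, mul_sub, sub_mul]

theorem c_mul_c_mul_lin (v : Fin n → k) :
    c k n * (c k n * lin v) = -(c k n * lin v * c k n) := by
  rw [mul_assoc, ← mul_neg, ← c_mul_lin]

theorem isUnit_oddFactor (A : Matrix (Fin n) (Fin n) k) : IsUnit (oddFactor A) := by
  rw [oddFactor]
  refine List.prod_isUnit fun b hb => ?_
  obtain ⟨p, -, rfl⟩ := List.mem_map.1 hb
  exact IsNilpotent.isUnit_one_add ⟨2, by simp [pow_two, x_mul_x]⟩

theorem commute_oddFactor {A : Matrix (Fin n) (Fin n) k} {b : E k n ⊗[k] E k n}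
    (h : ∀ p, Commute b (x k p ⊗ₜ[k] (c k n * lin (A p)))) : Commute b (oddFactor A) := by
  refine Commute.list_prod_right _ _ fun d hd => ?_
  obtain ⟨p, -, rfl⟩ := List.mem_map.1 hd
  exact (Commute.one_right _).add_right (h p)

theorem commute_comul_c_oddFactor (A : Matrix (Fin n) (Fin n) k) :
    Commute (c k n ⊗ₜ[k] c k n) (oddFactor A) :=
  commute_oddFactor fun p => commute_tmul (c_mul_x p) (c_mul_c_mul_lin _)

theorem commute_comul_x_oddFactor (A : Matrix (Fin n) (Fin n) k) (i : Fin n) :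
    Commute (1 ⊗ₜ[k] x k i + x k i ⊗ₜ[k] c k n) (oddFactor A) := by
  refine commute_oddFactor fun p => Commute.add_left ?_
    (commute_tmul (x_mul_x_anti i p) (c_mul_c_mul_lin _))
  have h : x k i * c k n = -(c k n * x k i) := by rw [c_mul_x, neg_neg]
  rw [Commute, SemiconjBy, Algebra.TensorProduct.tmul_mul_tmul,
    Algebra.TensorProduct.tmul_mul_tmul, one_mul, mul_one, ← mul_assoc, h, neg_mul, mul_assoc,
    x_mul_lin, mul_neg, neg_neg, mul_assoc]

/-- Both sides are multiplicative in h, so generators suffice. There T_A commutes with Δ(h), and the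
statement becomes τ(Δ(h)) g = g Δ(h). -/
theorem flip_comul_mul (A : Matrix (Fin n) (Fin n) k) (h : E k n) :
    QT.flip k (E k n) (Coalgebra.comul h) * (groupR k n * oddFactor A) =
      groupR k n * oddFactor A * Coalgebra.comul h := by
  induction h using E.induction with
  | hk r =>
    rw [Bialgebra.comul_algebraMap, AlgHom.commutes, Algebra.commutes]
  | hc =>
    rw [comul_c, mul_assoc, ← (commute_comul_c_oddFactor A).eq, ← mul_assoc, ← mul_assoc]
    have : c k n ⊗ₜ[k] c k n = (c k n ⊗ₜ[k] 1) * (1 ⊗ₜ[k] c k n) := by simp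
    congr 1
    simp only [QT.flip]
    exact (this ▸ commute_c_tmul_one_groupR.mul_left commute_one_tmul_c_groupR).eq
  | hx i =>
    rw [comul_x, mul_assoc, ← (commute_comul_x_oddFactor A i).eq, ← mul_assoc, ← mul_assoc]
    congr 1
    have h1 := odd_tmul_one_mul_groupR (k := k) (c_mul_x i)
    have h2 := one_tmul_odd_mul_groupR (k := k) (c_mul_x i)
    have h3 : QT.flip k (E k n) (1 ⊗ₜ[k] x k i + x k i ⊗ₜ[k] c k n) =
        x k i ⊗ₜ[k] 1 + (c k n ⊗ₜ[k] 1) * (1 ⊗ₜ[k] x k i) := by simp [QT.flip]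
    rw [h3, add_mul, h1, mul_assoc, h2, ← mul_assoc, commute_c_tmul_one_groupR.eq, mul_assoc]
    simp [mul_add, add_comm, c_mul_c]
  | hadd a b ha hb => simp only [map_add, add_mul, mul_add, ha, hb]
  | hmul a b ha hb =>
    rw [Bialgebra.comul_mul, map_mul, mul_assoc, hb, ← mul_assoc, ha, mul_assoc]

end E

/-! ### The hexagon identities. -/

namespace QT

variable {k : Type*} [CommRing k] {H : Type*} [Ring H] [HopfAlgebra k H]

@[simp] theorem flip_tmul (a b : H) : flip k H (a ⊗ₜ[k] b) = b ⊗ₜ[k] a := rfl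

@[simp] theorem leg12_tmul (a b : H) : leg12 k H (a ⊗ₜ[k] b) = a ⊗ₜ[k] (b ⊗ₜ[k] 1) := rfl

@[simp] theorem leg13_tmul (a b : H) : leg13 k H (a ⊗ₜ[k] b) = a ⊗ₜ[k] (1 ⊗ₜ[k] b) := rfl

@[simp] theorem leg23_apply (t : H ⊗[k] H) : leg23 k H t = 1 ⊗ₜ[k] t := rfl

@[simp] theorem comulRight_tmul (a b : H) :
    comulRight k H (a ⊗ₜ[k] b) = a ⊗ₜ[k] Coalgebra.comul (R := k) b := rfl

@[simp] theorem comulLeft_tmul (a b : H) :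
    comulLeft k H (a ⊗ₜ[k] b) =
      TensorProduct.assoc k H H H (Coalgebra.comul (R := k) a ⊗ₜ[k] b) := rfl

theorem commute_one_tmul_leg12 (z : H) (t : H ⊗[k] H) :
    Commute (1 ⊗ₜ[k] (1 ⊗ₜ[k] z)) (leg12 k H t) := by
  induction t using TensorProduct.induction_on with
  | zero => simp
  | tmul a b => simp [Commute, SemiconjBy]
  | add a b ha hb => rw [map_add]; exact ha.add_right hb

end QT

namespace E

variable {k : Type*} [Field k] {n : ℕ}

theorem map_oddFactor {B : Type*} [Ring B] [Algebra k B] (φ : E k n ⊗[k] E k n →ₐ[k] B)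
    (A : Matrix (Fin n) (Fin n) k) :
    φ (oddFactor A) =
      ((List.finRange n).map fun p => 1 + φ (x k p ⊗ₜ[k] (c k n * lin (A p)))).prod := by
  simp only [oddFactor, map_list_prod, List.map_map, Function.comp_def, map_add, map_one]

/-- The product of the elements `1 + x_p ⊗ c ⊗ c y_p`, where `y_p = ∑ a_{pj} x_j`. -/
def midFactor (A : Matrix (Fin n) (Fin n) k) : E k n ⊗[k] (E k n ⊗[k] E k n) :=
  ((List.finRange n).map fun p => 1 + x k p ⊗ₜ[k] (c k n ⊗ₜ[k] (c k n * lin (A p)))).prod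

theorem one_add_mul_one_add_of_mul_eq_zero {B : Type*} [Ring B] {a b : B} (h : a * b = 0) :
    (1 + a) * (1 + b) = 1 + (a + b) := by
  rw [add_mul, mul_add, mul_add, h, one_mul, one_mul, mul_one]
  abel

theorem c_mul_lin_sq (h2 : (2 : k) ≠ 0) (v : Fin n → k) :
    (c k n * lin v) * (c k n * lin v) = 0 := by
  rw [c_mul_lin_mul_c_mul_lin, lin_mul_lin_self h2, neg_zero]

/-- Δ ⊗ id sends x_p ⊗ c y_p to x_p ⊗ c ⊗ c y_p + 1 ⊗ x_p ⊗ c y_p. The product of these summands is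
zero because (c y_p)² = 0, so each factor splits in two, and all the pieces commute. -/
theorem comulLeft_oddFactor (h2 : (2 : k) ≠ 0) (A : Matrix (Fin n) (Fin n) k) :
    QT.comulLeft k (E k n) (oddFactor A) =
      midFactor A * QT.leg23 k (E k n) (oddFactor A) := by
  rw [map_oddFactor, map_oddFactor, midFactor, ← List.prod_map_mul_of_commute]
  · congr 1
    refine List.map_congr_left fun p _ => ?_
    rw [one_add_mul_one_add_of_mul_eq_zero
      (by simp only [QT.leg23_apply, Algebra.TensorProduct.tmul_mul_tmul, c_mul_lin_sq h2,
        TensorProduct.tmul_zero])]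
    simp [TensorProduct.add_tmul, add_comm]
  · intro i j
    refine (Commute.one_left _).add_left ((Commute.one_right _).add_right ?_)
    simp [Commute, SemiconjBy, c_mul_x, c_mul_lin_anti (A i) (A j), TensorProduct.tmul_neg,
      TensorProduct.neg_tmul]

/-- Here Δ(c y_p) = c ⊗ c y_p + c y_p ⊗ 1, and the cross term vanishes because x_p² = 0. -/
theorem comulRight_oddFactor (A : Matrix (Fin n) (Fin n) k) :
    QT.comulRight k (E k n) (oddFactor A) =
      midFactor A * QT.leg12 k (E k n) (oddFactor A) := by
  rw [map_oddFactor, map_oddFactor, midFactor, ← List.prod_map_mul_of_commute]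
  · congr 1
    refine List.map_congr_left fun p _ => ?_
    rw [one_add_mul_one_add_of_mul_eq_zero (by simp [x_mul_x])]
    simp [comul_lin, mul_add, c_mul_c, TensorProduct.tmul_add]
  · intro i j
    refine (Commute.one_left _).add_left ((Commute.one_right _).add_right ?_)
    have h := x_mul_x_anti (k := k) i j
    have h' := c_mul_c_mul_lin (A j)
    have h'' : c k n * lin (A i) * 1 = 1 * (c k n * lin (A i)) := by simp
    simp only [Commute, SemiconjBy, QT.leg12_tmul, Algebra.TensorProduct.tmul_mul_tmul, h, h',
      h'', TensorProduct.tmul_neg, TensorProduct.neg_tmul, neg_neg]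

/-- Passing g_23 to the left of an odd element in the third leg inserts a c in the middle leg. -/
theorem leg13_oddFactor_mul_leg23_groupR (A : Matrix (Fin n) (Fin n) k) :
    QT.leg13 k (E k n) (oddFactor A) * QT.leg23 k (E k n) (groupR k n) =
      QT.leg23 k (E k n) (groupR k n) * midFactor A := by
  rw [map_oddFactor, midFactor]
  refine List.prod_map_mul_eq_mul_prod_map _ _ _ _ fun p => ?_
  rw [add_mul, mul_add, one_mul, mul_one, QT.leg13_tmul, QT.leg23_apply,
    Algebra.TensorProduct.tmul_mul_tmul, Algebra.TensorProduct.tmul_mul_tmul,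
    one_tmul_odd_mul_groupR (c_mul_c_mul_lin _), one_mul, mul_one]

theorem leg13_oddFactor_mul_leg12_groupR (A : Matrix (Fin n) (Fin n) k) :
    QT.leg13 k (E k n) (oddFactor A) * QT.leg12 k (E k n) (groupR k n) =
      QT.leg12 k (E k n) (groupR k n) * midFactor A := by
  rw [map_oddFactor, midFactor]
  refine List.prod_map_mul_eq_mul_prod_map _ _ _ _ fun p => ?_
  -- The third leg is split off, since it commutes with everything in legs 1 and 2; what remains is
  -- the commutation rule for g.
  have h1 : QT.leg13 k (E k n) (x k p ⊗ₜ[k] (c k n * lin (A p))) =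
      QT.leg12 k (E k n) (x k p ⊗ₜ[k] 1) * (1 ⊗ₜ[k] (1 ⊗ₜ[k] (c k n * lin (A p)))) := by simp
  have h2 : x k p ⊗ₜ[k] (c k n ⊗ₜ[k] (c k n * lin (A p))) =
      QT.leg12 k (E k n) (x k p ⊗ₜ[k] c k n) *
        (1 ⊗ₜ[k] (1 ⊗ₜ[k] (c k n * lin (A p)))) := by simp
  rw [add_mul, mul_add, one_mul, mul_one, h1, h2, mul_assoc,
    (QT.commute_one_tmul_leg12 _ _).eq, ← mul_assoc, ← mul_assoc, ← map_mul, ← map_mul,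
    odd_tmul_one_mul_groupR (c_mul_x p)]

theorem comulLeft_groupR (h2 : (2 : k) ≠ 0) :
    QT.comulLeft k (E k n) (groupR k n) =
      QT.leg13 k (E k n) (groupR k n) * QT.leg23 k (E k n) (groupR k n) := by
  rw [groupR]
  simp only [map_smul, map_add, map_sub, QT.leg13_tmul, QT.leg23_apply, QT.comulLeft_tmul,
    comul_c, Bialgebra.comul_one, Algebra.TensorProduct.one_def, TensorProduct.assoc_tmul]
  rw [smul_mul_smul_comm]
  -- Without the factors ½, the product on the right is twice the left side.
  have hh : (1 / 2 : k) = 1 / 2 * (1 / 2) * 2 := by field_simp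
  rw [hh, mul_smul, ← hh]
  congr 1
  simp only [mul_add, add_mul, mul_sub, sub_mul,
    Algebra.TensorProduct.tmul_mul_tmul, one_mul, mul_one, c_mul_c]
  module

theorem comulRight_groupR (h2 : (2 : k) ≠ 0) :
    QT.comulRight k (E k n) (groupR k n) =
      QT.leg13 k (E k n) (groupR k n) * QT.leg12 k (E k n) (groupR k n) := by
  rw [groupR]
  simp only [map_smul, map_add, map_sub, QT.leg13_tmul, QT.leg12_tmul, QT.comulRight_tmul,
    comul_c, Bialgebra.comul_one, Algebra.TensorProduct.one_def]
  rw [smul_mul_smul_comm]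
  have hh : (1 / 2 : k) = 1 / 2 * (1 / 2) * 2 := by field_simp
  conv_lhs => rw [hh]
  rw [mul_smul]
  congr 1
  simp only [mul_add, add_mul, mul_sub, sub_mul,
    Algebra.TensorProduct.tmul_mul_tmul, one_mul, mul_one, c_mul_c]
  module

/-- With M = `midFactor A`, the first hexagon is g_13 g_23 M T_23 = g_13 T_13 g_23 T_23. The second
is the same computation with legs 1, 2 in place of 2, 3. -/
theorem isQuasiTriangular_RMatrix (h2 : (2 : k) ≠ 0) (A : Matrix (Fin n) (Fin n) k) :
    QT.IsQuasiTriangular k (RMatrix A) where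
  isUnit := by
    rw [RMatrix_eq h2]
    exact (show IsUnit (groupR k n) from ⟨⟨_, _, groupR_mul_self h2, groupR_mul_self h2⟩, rfl⟩).mul
      (isUnit_oddFactor A)
  comul_op h := by
    rw [RMatrix_eq h2]
    exact flip_comul_mul A h
  comul_left := by
    rw [RMatrix_eq h2]
    simp only [map_mul]
    rw [comulLeft_oddFactor h2, comulLeft_groupR h2, mul_assoc (QT.leg13 k _ (groupR k n)),
      ← mul_assoc (QT.leg23 k _ (groupR k n)), ← leg13_oddFactor_mul_leg23_groupR]
    simp only [mul_assoc]
  comul_right := by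
    rw [RMatrix_eq h2]
    simp only [map_mul]
    rw [comulRight_oddFactor, comulRight_groupR h2, mul_assoc (QT.leg13 k _ (groupR k n)),
      ← mul_assoc (QT.leg12 k _ (groupR k n)), ← leg13_oddFactor_mul_leg12_groupR]
    simp only [mul_assoc]

/-! ### The flip of the `R`-matrix -/

/-- The product of the elements `1 + y_p ⊗ c x_p`, where `y_p = ∑ a_{pj} x_j`. -/
def flipFactor (A : Matrix (Fin n) (Fin n) k) : E k n ⊗[k] E k n :=
  ((List.finRange n).map fun p => 1 + lin (A p) ⊗ₜ[k] (c k n * x k p)).prod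

/-- The product of the elements `1 - y_p ⊗ c x_p`, where `y_p = ∑ a_{pj} x_j`. -/
def flipFactorInv (A : Matrix (Fin n) (Fin n) k) : E k n ⊗[k] E k n :=
  ((List.finRange n).map fun p => 1 - lin (A p) ⊗ₜ[k] (c k n * x k p)).prod

theorem x_eq_lin (i : Fin n) : x k i = lin (Pi.single i 1) := by
  simp [lin, Pi.single_apply, ite_smul]

theorem c_mul_x_anti (i j : Fin n) :
    (c k n * x k i) * (c k n * x k j) = -((c k n * x k j) * (c k n * x k i)) := by
  rw [x_eq_lin i, x_eq_lin j, c_mul_lin_anti]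

theorem flipFactorInv_mul_flipFactor (h2 : (2 : k) ≠ 0) (A : Matrix (Fin n) (Fin n) k) :
    flipFactorInv A * flipFactor A = 1 := by
  have h : ∀ i j, Commute (lin (A i) ⊗ₜ[k] (c k n * x k i)) (lin (A j) ⊗ₜ[k] (c k n * x k j)) :=
    fun i j => commute_tmul (lin_mul_lin_anti _ _) (c_mul_x_anti i j)
  rw [flipFactorInv, flipFactor, ← List.prod_map_mul_of_commute]
  · refine List.prod_eq_one fun b hb => ?_
    obtain ⟨p, -, rfl⟩ := List.mem_map.1 hb
    rw [mul_add, sub_mul, sub_mul, mul_one, one_mul, mul_one, Algebra.TensorProduct.tmul_mul_tmul,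
      lin_mul_lin_self h2]
    simp
  · intro i j
    exact (Commute.one_left _).sub_left ((Commute.one_right _).add_right (h i j))

theorem flip_groupR : QT.flip k (E k n) (groupR k n) = groupR k n := by
  simp only [groupR, map_smul, map_add, map_sub, QT.flip_tmul]
  congr 1
  abel

/-- Moving g left past c y_p ⊗ x_p turns it into c y_p c ⊗ c x_p, and c y_p c = −y_p; hence the
minus signs in `flipFactorInv`. -/
theorem flip_oddFactor_mul_groupR (A : Matrix (Fin n) (Fin n) k) :
    QT.flip k (E k n) (oddFactor A) * groupR k n = groupR k n * flipFactorInv A := by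
  rw [map_oddFactor, flipFactorInv]
  refine List.prod_map_mul_eq_mul_prod_map _ _ _ _ fun p => ?_
  have h : QT.flip k (E k n) (x k p ⊗ₜ[k] (c k n * lin (A p))) =
      (c k n * lin (A p)) ⊗ₜ[k] 1 * (1 ⊗ₜ[k] x k p) := by simp
  rw [add_mul, mul_sub, one_mul, mul_one, h, mul_assoc, one_tmul_odd_mul_groupR (c_mul_x p),
    ← mul_assoc, odd_tmul_one_mul_groupR (c_mul_c_mul_lin _), sub_eq_add_neg, ← mul_neg,
    mul_assoc]
  congr 2
  rw [Algebra.TensorProduct.tmul_mul_tmul, ← neg_neg (c k n * lin (A p) * c k n),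
    ← c_mul_c_mul_lin, ← mul_assoc, c_mul_c, one_mul, TensorProduct.neg_tmul]

theorem flip_RMatrix_mul_RMatrix (h2 : (2 : k) ≠ 0) (A : Matrix (Fin n) (Fin n) k) :
    QT.flip k (E k n) (RMatrix A) * RMatrix A = flipFactorInv A * oddFactor A := by
  rw [RMatrix_eq h2, map_mul, flip_groupR, mul_assoc, ← mul_assoc (QT.flip k _ _),
    flip_oddFactor_mul_groupR, ← mul_assoc, ← mul_assoc, groupR_mul_self h2, one_mul]

/-! ### Transposition symmetry and recovery of A from the odd factor. -/

theorem oddFactor_eq_prod_prod (A : Matrix (Fin n) (Fin n) k) :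
    oddFactor A = ((List.finRange n).map fun i => ((List.finRange n).map fun j =>
      1 + A i j • (x k i ⊗ₜ[k] (c k n * x k j))).prod).prod := by
  rw [oddFactor]
  congr 1
  refine List.map_congr_left fun i _ => ?_
  rw [List.prod_map_one_add_of_mul_eq_zero _ _ (by simp [x_mul_x]), List.sum_map_finRange]
  simp [lin, Finset.mul_sum, TensorProduct.tmul_sum, TensorProduct.tmul_smul]

theorem flipFactor_eq_prod_prod (A : Matrix (Fin n) (Fin n) k) :
    flipFactor A = ((List.finRange n).map fun j => ((List.finRange n).map fun i =>
      1 + A j i • (x k i ⊗ₜ[k] (c k n * x k j))).prod).prod := by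
  rw [flipFactor]
  congr 1
  refine List.map_congr_left fun j _ => ?_
  have hj : (c k n * x k j) * (c k n * x k j) = 0 := by
    rw [x_eq_lin, c_mul_lin_mul_c_mul_lin, ← x_eq_lin, x_mul_x, neg_zero]
  rw [List.prod_map_one_add_of_mul_eq_zero _ _ (fun i i' => by
    rw [smul_mul_smul_comm, Algebra.TensorProduct.tmul_mul_tmul, hj]; simp),
    List.sum_map_finRange]
  simp [lin, TensorProduct.sum_tmul, TensorProduct.smul_tmul']

/-- Both are products of the commuting elementary factors 1 + a_{ji} x_i ⊗ c x_j, taken in different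
orders. -/
theorem flipFactor_eq_oddFactor_transpose (A : Matrix (Fin n) (Fin n) k) :
    flipFactor A = oddFactor A.transpose := by
  rw [flipFactor_eq_prod_prod, oddFactor_eq_prod_prod, List.prod_map_prod_map_comm]
  · rfl
  · intro i j i' j'
    refine (Commute.one_left _).add_left ((Commute.one_right _).add_right ?_)
    exact ((commute_tmul (x_mul_x_anti _ _) (c_mul_x_anti _ _)).smul_left _).smul_right _

/-- The representation of `E(n)` on `k²` in which `c` acts by `diag(1, -1)`, `x_i` by the
matrix unit `E₁₂`, and the other `x_j` by `0`. -/
def planeRep (i : Fin n) : E k n →ₐ[k] Matrix (Fin 2) (Fin 2) k :=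
  lift !![1, 0; 0, -1] (fun j => if j = i then !![0, 1; 0, 0] else 0)
    (by simp [Matrix.one_fin_two])
    (fun j => by split_ifs <;> simp [← Matrix.ext_iff, Fin.forall_fin_two])
    (fun j => by split_ifs <;> simp)
    (fun j l _ => by split_ifs <;> simp)

theorem planeRep_x (i j : Fin n) :
    planeRep i (x k j) = if j = i then !![0, 1; 0, 0] else 0 := lift_x ..

theorem planeRep_c_mul_lin (i : Fin n) (v : Fin n → k) :
    planeRep i (c k n * lin v) = v i • !![0, 1; 0, 0] := by
  have hc : planeRep i (c k n) = !![1, 0; 0, -1] := lift_c ..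
  simp [lin, hc, planeRep_x, smul_ite]

/-- Only the factor p = i survives, and there only the coefficient of x_j. This isolates a_{ij}
without a basis of E(n). -/
theorem map_planeRep_oddFactor (A : Matrix (Fin n) (Fin n) k) (i j : Fin n) :
    Algebra.TensorProduct.map (planeRep i) (planeRep j) (oddFactor A) =
      1 + A i j • (!![0, 1; 0, 0] ⊗ₜ[k] !![0, 1; 0, 0]) := by
  have hsq : (!![0, 1; 0, 0] : Matrix (Fin 2) (Fin 2) k) * !![0, 1; 0, 0] = 0 := by
    simp [← Matrix.ext_iff, Fin.forall_fin_two]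
  rw [map_oddFactor]
  simp only [Algebra.TensorProduct.map_tmul, planeRep_x, planeRep_c_mul_lin]
  generalize (!![0, 1; 0, 0] : Matrix (Fin 2) (Fin 2) k) = N at hsq ⊢
  rw [List.prod_map_one_add_of_mul_eq_zero, List.sum_map_finRange]
  · simp [TensorProduct.ite_tmul, TensorProduct.tmul_smul]
  · intro p q
    rw [Algebra.TensorProduct.tmul_mul_tmul, smul_mul_smul_comm, hsq]
    simp

theorem oddFactor_injective :
    Function.Injective (oddFactor : Matrix (Fin n) (Fin n) k → E k n ⊗[k] E k n) := by
  intro A B h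
  ext i j
  have hne : (!![0, 1; 0, 0] : Matrix (Fin 2) (Fin 2) k) ⊗ₜ[k]
      (!![0, 1; 0, 0] : Matrix (Fin 2) (Fin 2) k) ≠ 0 := fun h => by
    -- Reading the (0,1) entry in both legs and multiplying gives 1.
    simpa using congrArg (LinearMap.mul' k k ∘ₗ
      TensorProduct.map (Matrix.entryLinearMap k k 0 1) (Matrix.entryLinearMap k k 0 1)) h
  have h' := congrArg (Algebra.TensorProduct.map (planeRep i) (planeRep j)) h
  rw [map_planeRep_oddFactor, map_planeRep_oddFactor, add_right_inj] at h'
  exact smul_left_injective k hne h'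

theorem isTriangular_RMatrix_iff (h2 : (2 : k) ≠ 0) (A : Matrix (Fin n) (Fin n) k) :
    QT.IsTriangular k (RMatrix A) ↔ A.IsSymm := by
  constructor
  · intro h
    have h1 := h.flip_mul
    rw [flip_RMatrix_mul_RMatrix h2] at h1
    have h3 := flipFactorInv_mul_flipFactor h2 A
    have hu : IsUnit (flipFactor A) := by
      rw [flipFactor_eq_oddFactor_transpose]
      exact isUnit_oddFactor _
    -- `flipFactor A` is a unit, so its left inverse `flipFactorInv A` is its inverse, and τ(R_A)
    -- R_A = 1 becomes equality of the two factors.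
    have h4 : oddFactor A = flipFactor A := by
      obtain ⟨u, hu⟩ := hu
      have : flipFactorInv A = ↑u⁻¹ := by
        rw [← hu] at h3
        exact (Units.inv_eq_of_mul_eq_one_left h3).symm
      rw [this, Units.inv_mul_eq_one, hu] at h1
      exact h1.symm
    rw [flipFactor_eq_oddFactor_transpose] at h4
    exact (oddFactor_injective h4).symm
  · intro hA
    have hq := isQuasiTriangular_RMatrix h2 A
    have h1 : QT.flip k (E k n) (RMatrix A) * RMatrix A = 1 := by
      have h3 := flipFactorInv_mul_flipFactor h2 A
      rwa [flipFactor_eq_oddFactor_transpose, hA, ← flip_RMatrix_mul_RMatrix h2] at h3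
    exact { hq with
      mul_flip := by
        -- R_A is invertible, so its left inverse τ(R_A) is also a right inverse.
        obtain ⟨u, hu⟩ := hq.isUnit
        rw [← hu] at h1 ⊢
        rw [← Units.inv_eq_of_mul_eq_one_left h1, Units.mul_inv]
      flip_mul := h1 }

end E

theorem mainTheorem10 {k : Type*} [Field k] (hk : ringChar k ≠ 2) (n : ℕ)
    (A : Matrix (Fin n) (Fin n) k) :
    QT.IsQuasiTriangular k (E.RMatrix A) ∧
      (QT.IsTriangular k (E.RMatrix A) ↔ A.IsSymm) :=
  ⟨E.isQuasiTriangular_RMatrix (Ring.two_ne_zero hk) A,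
    E.isTriangular_RMatrix_iff (Ring.two_ne_zero hk) A⟩
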